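/- For $m\ge 1$ let $\mathbb{R}^m_s$ be $\mathbb{R}^m$ with $\langle u,v\rangle_s=-\sum_{i\le s}u_iv_i+\sum_{i>s}u_iv_i$, and let $S^5_2=\{x\in\mathbb{R}^6_2 : \langle x,x\rangle_2=1\}$. Let $N$ be $\mathbb{R}^5_2$ or $S^5_2$, with Levi-Civita connection $\bar\nabla$. Let $M$ be a smooth connected (immersed) non-degenerate hypersurface of $N$ of dimension $4$ with a smooth unit normal field $\xi$ ($\langle\xi,\xi\rangle=1$ everywhere or $\langle\xi,\xi\rangle=-1$ everywhere), induced metric $\langle\cdot,\cdot\rangle$ and shape operator $A(X)=-\bar\nabla_X\xi$. The principal curvatures at $x\in M$ are the complex eigenvalues of $A_x$, counted with algebraic multiplicity; $M$ is isoparametric if they are all constant on $M$. $M$ is of Petrov type II of index 2 if there are constants $\alpha_1,\alpha_2\in\mathbb{R}$ and $\beta_1,\beta_2>0$ such that for every $x\in M$ there is a basis of $T_xM$ in which the matrices of $A_x$ and of $\langle\cdot,\cdot\rangle_x$ are $$\begin{pmatrix}\alpha_1&-\beta_1&0&0\\ \beta_1&\alpha_1&0&0\\ 0&0&\alpha_2&-\beta_2\\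 0&0&\beta_2&\alpha_2\end{pmatrix},\qquad \begin{pmatrix}-1&0&0&0\\ 0&1&0&0\\ 0&0&-1&0\\ 0&0&0&1\end{pmatrix}.$$ **Theorem 4.5.** There is no isoparametric hypersurface of Petrov type II of index 2 in $\mathbb{R}^5_2$ or $S^5_2$ all of whose complex (non-real) principal curvatures have multiplicity $2$ (equivalently, with $\alpha_1=\alpha_2$ and $\beta_1=\beta_2$). -/

import Mathlib

open scoped Manifold ContDiff

noncomputable section

/-- The pseudo-inner product `⟨u, v⟩_s = ᵗu ((-E_s) ⊕ E_{m-s}) v` on `ℝ^m`. -/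
def pseudoInner (m s : ℕ) : LinearMap.BilinForm ℝ (Fin m → ℝ) :=
  Matrix.toBilin' (Matrix.diagonal fun i : Fin m => if (i : ℕ) < s then (-1 : ℝ) else 1)

/-- The two families of pseudo-Riemannian space forms of curvature `κ = 0` and `κ = 1`:
the pseudo-Euclidean spaces `ℝ^n_s` and the pseudo-spheres `S^n_s`. -/
inductive SpaceForm
  | euclidean
  | sphere

namespace SpaceForm

/-- The constant curvature `κ`. -/
def curvature : SpaceForm → ℝ
  | euclidean => 0
  | sphere => 1

/-- The number of coordinates of the pseudo-Euclidean space in which the `n`-dimensional space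
form lies: `ℝ^n_s` lies in itself, and `S^n_s` lies in `ℝ^{n+1}_s`. -/
def coordDim : SpaceForm → ℕ → ℕ
  | euclidean, n => n
  | sphere, n => n + 1

/-- The `n`-dimensional space form of index `s` as a set: `ℝ^n_s` is the whole space, and
`S^n_s = {x ∈ ℝ^{n+1}_s | ⟨x, x⟩_s = 1}` (for `s = n` one takes the component where the last
coordinate is positive). -/
def carrier : (N : SpaceForm) → (n s : ℕ) → Set (Fin (N.coordDim n) → ℝ)
  | euclidean, _, _ => Set.univ
  | sphere, n, s =>
      {x : Fin (n + 1) → ℝ | pseudoInner (n + 1) s x x = 1 ∧ (s = n → 0 < x (Fin.last n))}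

/-- The tangent space of the space form at its point `p`, as a linear subspace of the
surrounding pseudo-Euclidean space. -/
def tangent : (N : SpaceForm) → (n s : ℕ) → (p : Fin (N.coordDim n) → ℝ) →
    Submodule ℝ (Fin (N.coordDim n) → ℝ)
  | euclidean, _, _, _ => ⊤
  | sphere, n, s, p => LinearMap.ker (pseudoInner (n + 1) s p)

/-- The orthogonal projection `v ↦ v - κ ⟨p, v⟩_s p` of the surrounding pseudo-Euclidean space
onto the tangent space of the space form at its point `p`. -/
def tangentProj (N : SpaceForm) (n s : ℕ) (p : Fin (N.coordDim n) → ℝ) :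
    (Fin (N.coordDim n) → ℝ) →ₗ[ℝ] (Fin (N.coordDim n) → ℝ) :=
  LinearMap.id - N.curvature • (pseudoInner (N.coordDim n) s p).smulRight p

end SpaceForm

section Immersions

variable {n m : ℕ} {M : Type*} [TopologicalSpace M] [ChartedSpace (EuclideanSpace ℝ (Fin n)) M]

/-- The differential at `x` of a map from an `n`-manifold to `ℝ^m`. -/
def differential (f : M → Fin m → ℝ) (x : M) : TangentSpace (𝓡 n) x →ₗ[ℝ] (Fin m → ℝ) :=
  (mfderiv (𝓡 n) 𝓘(ℝ, Fin m → ℝ) f x).toLinearMap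

/-- The metric that a map to `ℝ^m_s` induces on the tangent space at `x`. -/
def inducedMetric (s : ℕ) (f : M → Fin m → ℝ) (x : M) :
    LinearMap.BilinForm ℝ (TangentSpace (𝓡 n) x) :=
  (pseudoInner m s).compl₁₂ (differential f x) (differential f x)

end Immersions

/-- A non-degenerate (immersed) hypersurface `ι : M → N^{n+1}_s(κ)` of an
`(n+1)`-dimensional space form, together with a smooth unit normal vector field `ξ`. Embedded
hypersurfaces are the case in which `ι` is the inclusion map. -/
structure Hypersurface (N : SpaceForm) (n s : ℕ) (M : Type*) [TopologicalSpace M]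
    [ChartedSpace (EuclideanSpace ℝ (Fin n)) M] where
  /-- the immersion, in the coordinates of the surrounding pseudo-Euclidean space -/
  ι : M → Fin (N.coordDim (n + 1)) → ℝ
  smooth_ι : ContMDiff (𝓡 n) 𝓘(ℝ, Fin (N.coordDim (n + 1)) → ℝ) ∞ ι
  mem_carrier : ∀ x, ι x ∈ N.carrier (n + 1) s
  immersion : ∀ x, Function.Injective (differential (n := n) ι x)
  nondegenerate : ∀ x, (inducedMetric (n := n) s ι x).Nondegenerate
  /-- the unit normal vector field -/
  ξ : M → Fin (N.coordDim (n + 1)) → ℝ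
  smooth_ξ : ContMDiff (𝓡 n) 𝓘(ℝ, Fin (N.coordDim (n + 1)) → ℝ) ∞ ξ
  ξ_tangent : ∀ x, ξ x ∈ N.tangent (n + 1) s (ι x)
  ξ_normal : ∀ x (X : TangentSpace (𝓡 n) x),
    pseudoInner (N.coordDim (n + 1)) s (ξ x) (differential ι x X) = 0
  ξ_unit : (∀ x, pseudoInner (N.coordDim (n + 1)) s (ξ x) (ξ x) = 1) ∨
    (∀ x, pseudoInner (N.coordDim (n + 1)) s (ξ x) (ξ x) = -1)

namespace Hypersurface

variable {N : SpaceForm} {n s : ℕ} {M : Type*} [TopologicalSpace M]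
  [ChartedSpace (EuclideanSpace ℝ (Fin n)) M]

/-- The metric of the hypersurface. -/
def metric (H : Hypersurface N n s M) (x : M) : LinearMap.BilinForm ℝ (TangentSpace (𝓡 n) x) :=
  inducedMetric s H.ι x

/-- The covariant derivative `∇̄_X ξ` along `ι` of the unit normal field, for the Levi-Civita
connection of the space form: the tangential part of the derivative of `ξ` in the surrounding
pseudo-Euclidean space. -/
def covDerivNormal (H : Hypersurface N n s M) (x : M) :
    TangentSpace (𝓡 n) x →ₗ[ℝ] (Fin (N.coordDim (n + 1)) → ℝ) :=
  N.tangentProj (n + 1) s (H.ι x) ∘ₗ differential H.ξ x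

theorem pseudoInner_comm (m s : ℕ) (u v : Fin m → ℝ) :
    pseudoInner m s u v = pseudoInner m s v u := by
  simp only [pseudoInner, Matrix.toBilin'_apply', Matrix.mulVec_diagonal, dotProduct]
  exact Finset.sum_congr rfl fun i _ => by ring

theorem pseudoInner_differential_add {m k s : ℕ} {M : Type*} [TopologicalSpace M]
    [ChartedSpace (EuclideanSpace ℝ (Fin k)) M] {f g : M → Fin m → ℝ} {x : M} {c : ℝ}
    (hf : MDifferentiableAt (𝓡 k) 𝓘(ℝ, Fin m → ℝ) f x)
    (hg : MDifferentiableAt (𝓡 k) 𝓘(ℝ, Fin m → ℝ) g x)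
    (h : ∀ y, pseudoInner m s (f y) (g y) = c) (X : TangentSpace (𝓡 k) x) :
    pseudoInner m s (differential f x X) (g x) +
      pseudoInner m s (f x) (differential g x X) = 0 := by
  have hB := (LinearMap.toContinuousBilinearMap (pseudoInner m s)).isBoundedBilinearMap
  have h0 : HasMFDerivAt (𝓡 k) 𝓘(ℝ, (Fin m → ℝ) × (Fin m → ℝ)) (fun y => (f y, g y)) x
      ((mfderiv (𝓡 k) 𝓘(ℝ, Fin m → ℝ) f x).prod (mfderiv (𝓡 k) 𝓘(ℝ, Fin m → ℝ) g x)) :=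
    ⟨hf.hasMFDerivAt.1.prodMk hg.hasMFDerivAt.1, hf.hasMFDerivAt.2.prodMk hg.hasMFDerivAt.2⟩
  have h1 := HasMFDerivAt.comp (I' := 𝓘(ℝ, (Fin m → ℝ) × (Fin m → ℝ))) (f := fun y => (f y, g y)) x
    (hB.hasFDerivAt (f x, g x)).hasMFDerivAt h0
  have h2 : HasMFDerivAt (𝓡 k) 𝓘(ℝ, ℝ) (fun _ : M => c) x 0 := hasMFDerivAt_const c x
  have h3 : ((fun p : (Fin m → ℝ) × (Fin m → ℝ) =>
      LinearMap.toContinuousBilinearMap (pseudoInner m s) p.1 p.2) ∘ fun y => (f y, g y)) =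
      fun _ : M => c := funext h
  rw [h3] at h1
  have h4 := congrArg (fun L => L X) (hasMFDerivAt_unique h1 h2)
  have h5 : pseudoInner m s (f x) (differential g x X) +
    pseudoInner m s (differential f x X) (g x) = 0 := h4
  rw [add_comm]
  exact h5

theorem mem_range_of_orthogonal {m s : ℕ} {T : Type*} [AddCommGroup T] [Module ℝ T]
    (D : T →ₗ[ℝ] (Fin m → ℝ)) (hD : Function.Injective D) (hT : Module.finrank ℝ T + 1 = m)
    {ξ e : Fin m → ℝ} (hξξ : pseudoInner m s ξ ξ ≠ 0) (hξD : ∀ Y, pseudoInner m s ξ (D Y) = 0)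
    (he : pseudoInner m s ξ e = 0) : e ∈ LinearMap.range D := by
  have hsub : LinearMap.range D ≤ LinearMap.ker (pseudoInner m s ξ) := by
    rintro _ ⟨Y, rfl⟩
    exact hξD Y
  have hk : Module.finrank ℝ (LinearMap.ker (pseudoInner m s ξ)) = Module.finrank ℝ T := by
    have h1 := LinearMap.finrank_range_add_finrank_ker (pseudoInner m s ξ)
    have h2 : LinearMap.range (pseudoInner m s ξ) = ⊤ := by
      rw [LinearMap.range_eq_top]
      exact LinearMap.surjective (fun h => hξξ (by rw [h]; rfl))
    rw [h2, finrank_top, Module.finrank_self, Module.finrank_fin_fun] at h1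
    omega
  rw [Submodule.eq_of_le_of_finrank_eq hsub ((LinearMap.finrank_range_of_inj hD).trans hk.symm)]
  exact he

theorem sub_mem_range_of_orthogonal {m s : ℕ} {T : Type*} [AddCommGroup T] [Module ℝ T]
    (D : T →ₗ[ℝ] (Fin m → ℝ)) (hD : Function.Injective D) (hT : Module.finrank ℝ T + 2 = m)
    {p ξ e : Fin m → ℝ} (hξξ : pseudoInner m s ξ ξ ≠ 0) (hpp : pseudoInner m s p p = 1)
    (hpξ : pseudoInner m s p ξ = 0) (hξD : ∀ Y, pseudoInner m s ξ (D Y) = 0)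
    (hpD : ∀ Y, pseudoInner m s p (D Y) = 0) (he : pseudoInner m s ξ e = 0) :
    e - pseudoInner m s p e • p ∈ LinearMap.range D := by
  have hξp : pseudoInner m s ξ p = 0 := by rw [pseudoInner_comm, hpξ]
  have hsub : LinearMap.range D ≤
      LinearMap.ker ((pseudoInner m s ξ).prod (pseudoInner m s p)) := by
    rintro _ ⟨Y, rfl⟩
    exact Prod.ext (hξD Y) (hpD Y)
  have hk : Module.finrank ℝ (LinearMap.ker ((pseudoInner m s ξ).prod (pseudoInner m s p))) =
      Module.finrank ℝ T := by
    have h1 := LinearMap.finrank_range_add_finrank_ker ((pseudoInner m s ξ).prod (pseudoInner m s p))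
    have h2 : LinearMap.range ((pseudoInner m s ξ).prod (pseudoInner m s p)) = ⊤ := by
      rw [LinearMap.range_eq_top]
      rintro ⟨a, b⟩
      refine ⟨(a / pseudoInner m s ξ ξ) • ξ + b • p, ?_⟩
      refine Prod.ext ?_ ?_
      · change pseudoInner m s ξ _ = a
        rw [map_add, map_smul, map_smul, hξp, smul_eq_mul, smul_eq_mul, div_mul_cancel₀ _ hξξ]
        ring
      · change pseudoInner m s p _ = b
        rw [map_add, map_smul, map_smul, hpξ, hpp, smul_eq_mul, smul_eq_mul]
        ring
    rw [h2, finrank_top, Module.finrank_prod, Module.finrank_self, Module.finrank_fin_fun] at h1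
    omega
  rw [Submodule.eq_of_le_of_finrank_eq hsub ((LinearMap.finrank_range_of_inj hD).trans hk.symm)]
  refine Prod.ext ?_ ?_
  · change pseudoInner m s ξ _ = 0
    rw [map_sub, map_smul, hξp, smul_zero, sub_zero, he]
  · change pseudoInner m s p _ = 0
    rw [map_sub, map_smul, hpp, smul_eq_mul, mul_one, sub_self]

theorem covDerivNormal_mem_range (H : Hypersurface N n s M) (x : M) (X : TangentSpace (𝓡 n) x) :
    H.covDerivNormal x X ∈ LinearMap.range (differential (n := n) H.ι x) := by
  have dξ : MDifferentiableAt (𝓡 n) 𝓘(ℝ, Fin (N.coordDim (n + 1)) → ℝ) H.ξ x :=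
    H.smooth_ξ.mdifferentiableAt (by simp)
  have dι : MDifferentiableAt (𝓡 n) 𝓘(ℝ, Fin (N.coordDim (n + 1)) → ℝ) H.ι x :=
    H.smooth_ι.mdifferentiableAt (by simp)
  have hne : pseudoInner _ s (H.ξ x) (H.ξ x) ≠ 0 := by
    rcases H.ξ_unit with h | h <;> rw [h x] <;> norm_num
  have hξ : pseudoInner _ s (H.ξ x) (differential H.ξ x X) = 0 := by
    obtain ⟨c, hc⟩ : ∃ c, ∀ y, pseudoInner _ s (H.ξ y) (H.ξ y) = c := by
      rcases H.ξ_unit with h | h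
      exacts [⟨_, h⟩, ⟨_, h⟩]
    have h := pseudoInner_differential_add dξ dξ hc X
    rw [pseudoInner_comm _ s (differential H.ξ x X)] at h
    linarith
  have hT : Module.finrank ℝ (TangentSpace (𝓡 n) x) = n := finrank_euclideanSpace_fin
  cases N with
  | euclidean =>
    have hproj : H.covDerivNormal x X = differential H.ξ x X := by
      simp [covDerivNormal, SpaceForm.tangentProj, SpaceForm.curvature]
    rw [hproj]
    exact mem_range_of_orthogonal _ (H.immersion x) (by rw [hT]; rfl) hne (H.ξ_normal x) hξ
  | sphere =>
    have hc : ∀ y, pseudoInner _ s (H.ι y) (H.ι y) = 1 := fun y => (H.mem_carrier y).1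
    have hpD : ∀ Y : TangentSpace (𝓡 n) x,
        pseudoInner _ s (H.ι x) (differential H.ι x Y) = 0 := by
      intro Y
      have h := pseudoInner_differential_add dι dι hc Y
      rw [pseudoInner_comm _ s (differential H.ι x Y)] at h
      linarith
    have hproj : H.covDerivNormal x X = differential H.ξ x X -
        pseudoInner _ s (H.ι x) (differential H.ξ x X) • H.ι x := by
      simp only [covDerivNormal, SpaceForm.tangentProj, SpaceForm.curvature, one_smul]
      rfl
    rw [hproj]
    exact sub_mem_range_of_orthogonal _ (H.immersion x) (by rw [hT]; rfl) hne (hc x)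
      (H.ξ_tangent x) (H.ξ_normal x) hpD hξ

/-- The shape operator `A`, defined by `dι (A X) = -∇̄_X ξ`. -/
def shapeOperator (H : Hypersurface N n s M) (x : M) : Module.End ℝ (TangentSpace (𝓡 n) x) :=
  -((LinearEquiv.ofInjective (differential H.ι x) (H.immersion x)).symm.toLinearMap ∘ₗ
    (H.covDerivNormal x).codRestrict _ (H.covDerivNormal_mem_range x))

theorem differential_shapeOperator (H : Hypersurface N n s M) (x : M)
    (X : TangentSpace (𝓡 n) x) :
    differential H.ι x (H.shapeOperator x X) = -H.covDerivNormal x X := by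
  have h := LinearEquiv.apply_symm_apply
    (LinearEquiv.ofInjective (differential H.ι x) (H.immersion x))
    ((H.covDerivNormal x).codRestrict _ (H.covDerivNormal_mem_range x) X)
  have h' := congrArg Subtype.val h
  simp only [LinearEquiv.ofInjective_apply, LinearMap.codRestrict_apply] at h'
  simp only [shapeOperator, LinearMap.neg_apply, LinearMap.comp_apply, map_neg, neg_inj]
  exact h'

instance finiteDimensional_tangentSpace (x : M) :
    FiniteDimensional ℝ (TangentSpace (𝓡 n) x) :=
  inferInstanceAs (FiniteDimensional ℝ (EuclideanSpace ℝ (Fin n)))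

/-- The principal curvatures at `x`: the complex eigenvalues of the shape operator, counted with
their algebraic multiplicities. -/
def principalCurvatures (H : Hypersurface N n s M) (x : M) : Multiset ℂ :=
  ((H.shapeOperator x).charpoly.map (algebraMap ℝ ℂ)).roots

/-- The principal curvatures are all constant on `M`. -/
def IsIsoparametric (H : Hypersurface N n s M) : Prop :=
  ∀ x y, H.principalCurvatures x = H.principalCurvatures y

/-- The multiplicity of every complex (that is, non-real) principal curvature is `2`. -/
def ComplexMultiplicitiesEqTwo (H : Hypersurface N n s M) : Prop :=
  ∀ x, ∀ z ∈ H.principalCurvatures x, z.im ≠ 0 → (H.principalCurvatures x).count z = 2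

end Hypersurface

/-- The normal form of type II of index 2 in dimension 4: in a suitable basis, the matrix of the
endomorphism `A` and the Gram matrix of the bilinear form `g` are the displayed ones. -/
def HasPetrovFormII {V : Type*} [AddCommGroup V] [Module ℝ V] (A : Module.End ℝ V)
    (g : LinearMap.BilinForm ℝ V) (α₁ β₁ α₂ β₂ : ℝ) : Prop :=
  ∃ e : Module.Basis (Fin 4) ℝ V,
    LinearMap.toMatrix e e A =
      !![α₁, -β₁, 0, 0;
         β₁, α₁, 0, 0;
         0, 0, α₂, -β₂;
         0, 0, β₂, α₂] ∧
    (Matrix.of fun i j => g (e i) (e j)) =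
      !![-1, 0, 0, 0;
         0, 1, 0, 0;
         0, 0, -1, 0;
         0, 0, 0, 1]

/-- A 4-dimensional hypersurface has Petrov type II of index 2 if at every point its shape operator
and its metric have the normal form of type II. The numbers `α₁, β₁, α₂, β₂` do not depend on the
point, because Petrov types are defined when the Jordan normal form of the shape operator is
constant. -/
def Hypersurface.IsPetrovTypeII {N : SpaceForm} {s : ℕ} {M : Type*} [TopologicalSpace M]
    [ChartedSpace (EuclideanSpace ℝ (Fin 4)) M] (H : Hypersurface N 4 s M) : Prop :=
  ∃ α₁ β₁ α₂ β₂ : ℝ, 0 < β₁ ∧ 0 < β₂ ∧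
    ∀ x, HasPetrovFormII (H.shapeOperator x) (H.metric x) α₁ β₁ α₂ β₂

end

/-! When the two complex pairs coincide, `A = α + β J` with `J² = -1` and `⟨JX, JY⟩ = -⟨X, Y⟩`. The
Weingarten formula then makes `df ∘ J` exact: it is the differential of `-β⁻¹(ξ + α f)`. Hence `G =
(f, -β⁻¹(ξ + α f))` has `dG X = (df X, df (J X))`, and its tangent spaces are isotropic for the
orthogonal sum of two copies of `⟨ , ⟩`. They are also invariant under the skew operator `I (u, v) =
(v, -u)`, which acts on them as `J`.

The second derivative of an isotropic map is normal to it (`secondDeriv_orthogonal`), and the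
presence of `I` makes it isotropic as well (`secondDeriv_isotropic`). The doubled space has index
`2s = 4 = dim M`, so tangent spaces are maximal isotropic and contain the second derivative
(`mem_range_of_isotropic`). Thus `d²f` is tangent to the hypersurface. Differentiating `⟨ξ, df X⟩ =
0` gives `⟨dξ Z, df X⟩ = 0` (`pseudoInner_fderiv_normal_eq_zero`), that is `⟨AZ, X⟩ = 0`, which is
impossible for `β ≠ 0`.

The argument is local and takes place in the surrounding linear space, so the flat and the spherical
case are treated alike. -/

/-! ### Second derivatives of maps with isotropic tangent spaces. -/

section IsotropicMaps

variable {E F : Type*} [NormedAddCommGroup E] [NormedSpace ℝ E] [NormedAddCommGroup F]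
  [NormedSpace ℝ F]

theorem bilin_fderiv_add_eq_zero (B : F →L[ℝ] F →L[ℝ] ℝ) {a b : E → F} {y : E}
    (ha : DifferentiableAt ℝ a y) (hb : DifferentiableAt ℝ b y)
    (h : ∀ᶠ z in nhds y, B (a z) (b z) = 0) (Z : E) :
    B (fderiv ℝ a y Z) (b y) + B (a y) (fderiv ℝ b y Z) = 0 := by
  have h1 := B.hasFDerivAt_of_bilinear ha.hasFDerivAt hb.hasFDerivAt
  have h2 : HasFDerivAt (fun z => B (a z) (b z)) (0 : E →L[ℝ] ℝ) y :=
    (hasFDerivAt_const (0 : ℝ) y).congr_of_eventuallyEq h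
  have h3 := congrArg (fun L => L Z) (h1.unique h2)
  simpa [add_comm] using h3

variable {U : Set E} {G : E → F}

theorem ContDiffAt.fderiv_infty {y : E} (hG : ContDiffAt ℝ ∞ G y) :
    ContDiffAt ℝ ∞ (fderiv ℝ G) y :=
  hG.fderiv_right (by exact_mod_cast le_top)

theorem ContDiffAt.differentiableAt_fderiv_apply {y : E} (hG : ContDiffAt ℝ ∞ G y) (X : E) :
    DifferentiableAt ℝ (fun z => fderiv ℝ G z X) y :=
  (hG.fderiv_infty.differentiableAt (by simp)).clm_apply
    (differentiableAt_const X)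

theorem ContDiffAt.fderiv_fderiv_apply {y : E} (hG : ContDiffAt ℝ ∞ G y) (X Z : E) :
    fderiv ℝ (fun z => fderiv ℝ G z X) y Z = fderiv ℝ (fderiv ℝ G) y Z X := by
  rw [fderiv_clm_apply
    (hG.fderiv_infty.differentiableAt (by simp))
    (differentiableAt_const X)]
  simp

theorem two_le_infty : (2 : WithTop ℕ∞) ≤ ∞ := by
  exact WithTop.coe_le_coe.2 (le_top : (2 : ℕ∞) ≤ ⊤)

theorem ContDiffAt.fderiv_fderiv_comm {y : E} (hG : ContDiffAt ℝ ∞ G y) (X Z : E) :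
    fderiv ℝ (fderiv ℝ G) y X Z = fderiv ℝ (fderiv ℝ G) y Z X :=
  (hG.isSymmSndFDerivAt (by simpa using two_le_infty)).eq X Z

/-- The second derivative of a map with isotropic tangent spaces is normal. -/
theorem secondDeriv_orthogonal (hU : IsOpen U) (hG : ∀ y ∈ U, ContDiffAt ℝ ∞ G y)
    (B : F →L[ℝ] F →L[ℝ] ℝ) (hB : ∀ u v, B u v = B v u)
    (hiso : ∀ y ∈ U, ∀ X Y, B (fderiv ℝ G y X) (fderiv ℝ G y Y) = 0) {y : E} (hy : y ∈ U)
    (Z X Y : E) : B (fderiv ℝ (fderiv ℝ G) y Z X) (fderiv ℝ G y Y) = 0 := by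
  have hG' := hG y hy
  have key : ∀ Z X Y, B (fderiv ℝ (fderiv ℝ G) y Z X) (fderiv ℝ G y Y) +
      B (fderiv ℝ (fderiv ℝ G) y Z Y) (fderiv ℝ G y X) = 0 := by
    intro Z X Y
    have h := bilin_fderiv_add_eq_zero B (hG'.differentiableAt_fderiv_apply X)
      (hG'.differentiableAt_fderiv_apply Y)
      (Filter.eventually_of_mem (hU.mem_nhds hy) fun z hz => hiso z hz X Y) Z
    rwa [hG'.fderiv_fderiv_apply, hG'.fderiv_fderiv_apply, hB (fderiv ℝ G y X)] at h
  -- As in the Koszul formula: a trilinear form symmetric in its first two arguments and skew in its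
  -- last two vanishes.
  have h1 := key Z X Y
  have h2 := key X Y Z
  have h3 := key Y Z X
  rw [hG'.fderiv_fderiv_comm X Y] at h2
  rw [hG'.fderiv_fderiv_comm Y Z] at h3
  rw [hG'.fderiv_fderiv_comm X Z] at h2
  linarith

/-- If moreover the tangent spaces are invariant under a `B`-skew complex structure `I`, then the
image of the second derivative is isotropic. -/
theorem secondDeriv_isotropic (hU : IsOpen U) (hG : ∀ y ∈ U, ContDiffAt ℝ ∞ G y)
    (B : F →L[ℝ] F →L[ℝ] ℝ) (hB : ∀ u v, B u v = B v u)
    (hiso : ∀ y ∈ U, ∀ X Y, B (fderiv ℝ G y X) (fderiv ℝ G y Y) = 0)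
    (I : F →L[ℝ] F) (hI : ∀ u v, B (I u) v = -B u (I v))
    (J : E → E → E) (hJ : ∀ y ∈ U, ∀ X, fderiv ℝ G y (J y X) = I (fderiv ℝ G y X))
    (hJs : ∀ y ∈ U, Function.Surjective (J y)) {y : E} (hy : y ∈ U) (Z X V Y : E) :
    B (fderiv ℝ (fderiv ℝ G) y Z X) (fderiv ℝ (fderiv ℝ G) y V Y) = 0 := by
  have hG' := hG y hy
  have hnhds := hU.mem_nhds hy
  have hperp := fun z hz => secondDeriv_orthogonal hU hG B hB hiso (y := z) hz
  set Q : E → E → E → E → ℝ := fun Z X V Y =>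
    B (fderiv ℝ (fderiv ℝ G) y Z X) (fderiv ℝ (fderiv ℝ G) y V Y) with hQ
  have s1 : ∀ Z X V Y, Q Z X V Y = Q X Z V Y := fun Z X V Y => by
    simp only [hQ, hG'.fderiv_fderiv_comm Z X]
  have s2 : ∀ Z X V Y, Q Z X V Y = Q V Y Z X := fun Z X V Y => by simp only [hQ, hB]
  have hd2 : ∀ Z X, DifferentiableAt ℝ (fun z => fderiv ℝ (fderiv ℝ G) z Z X) y := fun Z X =>
    (hG'.fderiv_infty.differentiableAt_fderiv_apply Z).clm_apply (differentiableAt_const X)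
  -- Differentiating normality expresses `Q` through the third derivative, whose symmetry passes to
  -- `Q`. With `s1` and `s2`, `Q` becomes symmetric in all four arguments.
  have s3 : ∀ Z X V Y, Q Z X V Y = Q V X Z Y := by
    have key : ∀ V Z X Y, B (fderiv ℝ (fderiv ℝ (fderiv ℝ G)) y V Z X) (fderiv ℝ G y Y) +
        Q Z X V Y = 0 := by
      intro V Z X Y
      have h := bilin_fderiv_add_eq_zero B (hd2 Z X) (hG'.differentiableAt_fderiv_apply Y)
        (Filter.eventually_of_mem hnhds fun z hz => hperp z hz Z X Y) V
      rw [hG'.fderiv_fderiv_apply, fderiv_clm_apply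
        (hG'.fderiv_infty.differentiableAt_fderiv_apply Z) (differentiableAt_const X)] at h
      simpa [hG'.fderiv_infty.fderiv_fderiv_apply] using h
    intro Z X V Y
    have h1 := key V Z X Y
    have h2 := key Z V X Y
    rw [hG'.fderiv_infty.fderiv_fderiv_comm Z V] at h2
    linarith
  have hlin : ∀ Z X V Y, Q Z (J y X) V Y =
      B (I (fderiv ℝ (fderiv ℝ G) y Z X)) (fderiv ℝ (fderiv ℝ G) y V Y) := by
    intro Z X V Y
    have hI1 : DifferentiableAt ℝ (fun z => I (fderiv ℝ G z X)) y :=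
      I.differentiableAt.comp y (hG'.differentiableAt_fderiv_apply X)
    have hI2 : fderiv ℝ (fun z => I (fderiv ℝ G z X)) y Z =
        I (fderiv ℝ (fderiv ℝ G) y Z X) := by
      rw [← hG'.fderiv_fderiv_apply]
      exact congrArg (fun L => L Z) (I.hasFDerivAt.comp y
        (hG'.differentiableAt_fderiv_apply X).hasFDerivAt).fderiv
    -- The vector `J y X` is frozen at the base point, so `J` is never differentiated and needs no
    -- regularity. The field `a` is tangent, hence orthogonal to second derivatives, and it vanishes
    -- at `y`, which kills the other term of the product rule.
    have h := bilin_fderiv_add_eq_zero B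
      (a := fun z => I (fderiv ℝ G z X) - fderiv ℝ G z (J y X))
      (hI1.sub (hG'.differentiableAt_fderiv_apply (J y X))) (hd2 V Y)
      (Filter.eventually_of_mem hnhds fun z hz => by
        rw [← hJ z hz, ← map_sub, hB]
        exact hperp z hz V Y _) Z
    rw [hJ y hy, sub_self, map_zero, zero_apply, add_zero,
      fderiv_fun_sub hI1 (hG'.differentiableAt_fderiv_apply (J y X)),
      sub_apply, hI2, hG'.fderiv_fderiv_apply, map_sub,
      sub_apply] at h
    simp only [hQ]
    linarith
  have hskew : ∀ Z X V Y, Q Z (J y X) V Y = -Q Z X V (J y Y) := by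
    intro Z X V Y
    rw [hlin, hI, s2 Z X, hlin, hB]
  obtain ⟨W, rfl⟩ := hJs y hy X
  change Q Z (J y W) V Y = 0
  have s34 : ∀ Z X V Y, Q Z X V Y = Q Z X Y V := fun Z X V Y => by rw [s2, s1, s2]
  have s23 : ∀ Z X V Y, Q Z X V Y = Q Z V X Y := fun Z X V Y => by rw [s1, s3, s1]
  -- Moving `J` from one slot to another changes the sign. Carrying it around the three slots `W`,
  -- `Y`, `V` and back takes three moves, so the value equals its own negative.
  have e1 := hskew Z W V Y
  have e2 := hskew Z Y W V
  have e3 := hskew Z V Y W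
  rw [s23, s34] at e2
  rw [s23, s34, s34 Z V, s23 Z V] at e3
  linarith

end IsotropicMaps

/-! ### The doubled inner product and its maximal isotropic subspaces. -/

theorem pseudoInner_apply (m s : ℕ) (u v : Fin m → ℝ) :
    pseudoInner m s u v = ∑ i : Fin m, (if (i : ℕ) < s then (-1 : ℝ) else 1) * u i * v i := by
  simp only [pseudoInner, Matrix.toBilin'_apply', Matrix.mulVec_diagonal, dotProduct]
  exact Finset.sum_congr rfl fun i _ => by ring

theorem pseudoInner_self_nonneg {m s : ℕ} {u : Fin m → ℝ} (h : ∀ i : Fin m, (i : ℕ) < s → u i = 0) :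
    0 ≤ pseudoInner m s u u := by
  rw [pseudoInner_apply]
  refine Finset.sum_nonneg fun i _ => ?_
  by_cases hi : (i : ℕ) < s
  · simp [h i hi]
  · simpa [hi] using mul_self_nonneg (u i)

theorem eq_zero_of_pseudoInner_self {m s : ℕ} {u : Fin m → ℝ}
    (h : ∀ i : Fin m, (i : ℕ) < s → u i = 0) (hu : pseudoInner m s u u = 0) : u = 0 := by
  funext i
  by_cases hi : (i : ℕ) < s
  · exact h i hi
  rw [pseudoInner_apply, Finset.sum_eq_zero_iff_of_nonneg] at hu
  · simpa [hi] using hu i (Finset.mem_univ i)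
  · intro j _
    by_cases hj : (j : ℕ) < s
    · simp [h j hj]
    · simpa [hj] using mul_self_nonneg (u j)

/-- The orthogonal sum of two copies of the pseudo-Euclidean inner product. -/
noncomputable def doubledInner (m s : ℕ) :
    ((Fin m → ℝ) × (Fin m → ℝ)) →L[ℝ] ((Fin m → ℝ) × (Fin m → ℝ)) →L[ℝ] ℝ :=
  (LinearMap.toContinuousBilinearMap (pseudoInner m s)).bilinearComp
      (ContinuousLinearMap.fst ℝ _ _) (ContinuousLinearMap.fst ℝ _ _) +
    (LinearMap.toContinuousBilinearMap (pseudoInner m s)).bilinearComp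
      (ContinuousLinearMap.snd ℝ _ _) (ContinuousLinearMap.snd ℝ _ _)

theorem doubledInner_apply (m s : ℕ) (u v : (Fin m → ℝ) × (Fin m → ℝ)) :
    doubledInner m s u v = pseudoInner m s u.1 v.1 + pseudoInner m s u.2 v.2 := rfl

theorem doubledInner_comm (m s : ℕ) (u v : (Fin m → ℝ) × (Fin m → ℝ)) :
    doubledInner m s u v = doubledInner m s v u := by
  simp only [doubledInner_apply, Hypersurface.pseudoInner_comm m s u.1,
    Hypersurface.pseudoInner_comm m s u.2]

/-- An isotropic subspace of maximal dimension `2s` contains every null vector orthogonal to it. -/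
theorem mem_range_of_isotropic {m s : ℕ} (hm : s ≤ m) {E : Type*} [AddCommGroup E] [Module ℝ E]
    [FiniteDimensional ℝ E] (hE : Module.finrank ℝ E = 2 * s)
    (D : E →ₗ[ℝ] (Fin m → ℝ) × (Fin m → ℝ)) (hD : Function.Injective D)
    (hDD : ∀ X Y, doubledInner m s (D X) (D Y) = 0) {v : (Fin m → ℝ) × (Fin m → ℝ)}
    (hvD : ∀ X, doubledInner m s v (D X) = 0) (hv : doubledInner m s v v = 0) :
    ∃ X, D X = v := by
  let R : (Fin m → ℝ) →ₗ[ℝ] (Fin s → ℝ) := LinearMap.funLeft ℝ ℝ (Fin.castLE hm)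
  -- `P` keeps the `2s` negative coordinates, and the form is positive definite on its kernel. So
  -- `P` is injective on isotropic subspaces, and bijective on one of dimension `2s`.
  let P : (Fin m → ℝ) × (Fin m → ℝ) →ₗ[ℝ] (Fin s → ℝ) × (Fin s → ℝ) := R.prodMap R
  have hR : ∀ u, R u = 0 → ∀ i : Fin m, (i : ℕ) < s → u i = 0 := fun u hu i hi =>
    congrFun hu ⟨i, hi⟩
  have hP : ∀ u, P u = 0 → doubledInner m s u u = 0 → u = 0 := by
    intro u hu h0
    have h1 := hR u.1 (congrArg Prod.fst hu)
    have h2 := hR u.2 (congrArg Prod.snd hu)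
    have p1 := pseudoInner_self_nonneg h1
    have p2 := pseudoInner_self_nonneg h2
    rw [doubledInner_apply] at h0
    exact Prod.ext (eq_zero_of_pseudoInner_self h1 (by linarith))
      (eq_zero_of_pseudoInner_self h2 (by linarith))
  have hinj : Function.Injective (P ∘ₗ D) := by
    rw [← LinearMap.ker_eq_bot, LinearMap.ker_eq_bot']
    intro X hX
    exact hD ((hP (D X) hX (hDD X X)).trans (map_zero D).symm)
  have hsurj : Function.Surjective (P ∘ₗ D) := by
    rwa [← LinearMap.injective_iff_surjective_of_finrank_eq_finrank]
    rw [hE, Module.finrank_prod, Module.finrank_fin_fun]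
    ring
  obtain ⟨X, hX⟩ := hsurj (P v)
  -- `D X - v` is null because `v` is null and orthogonal to the range.
  refine ⟨X, sub_eq_zero.1 (hP (D X - v) ?_ ?_)⟩
  · rw [map_sub, sub_eq_zero]
    exact hX
  · rw [map_sub, map_sub, sub_apply, sub_apply, hDD, hvD, hv, doubledInner_comm, hvD]
    simp

/-! ### The isotropic lift of an immersion with shape operator `α + β J`. -/

section ComplexShape

variable {E : Type*} [NormedAddCommGroup E] [NormedSpace ℝ E]

/-- An immersion `f` of a `2s`-dimensional domain into `ℝ^m_s` with normal field `ξ` whose shape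
operator is `α + β J`, for an anti-isometric complex structure `J`, has `⟨dξ, df⟩ = 0`. -/
theorem pseudoInner_fderiv_normal_eq_zero {m s : ℕ} (hm : s ≤ m) [FiniteDimensional ℝ E]
    (hE : Module.finrank ℝ E = 2 * s) {U : Set E} (hU : IsOpen U) {f ξ : E → Fin m → ℝ}
    (hf : ∀ y ∈ U, ContDiffAt ℝ ∞ f y) (hξ : ∀ y ∈ U, ContDiffAt ℝ ∞ ξ y)
    (hinj : ∀ y ∈ U, Function.Injective (fderiv ℝ f y))
    (hn : ∀ y ∈ U, ∀ X, pseudoInner m s (ξ y) (fderiv ℝ f y X) = 0)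
    {α β : ℝ} (hβ : β ≠ 0) (J : E → E → E) (hJJ : ∀ y ∈ U, ∀ X, J y (J y X) = -X)
    (hJ : ∀ y ∈ U, ∀ X Y, pseudoInner m s (fderiv ℝ f y (J y X)) (fderiv ℝ f y (J y Y)) =
      -pseudoInner m s (fderiv ℝ f y X) (fderiv ℝ f y Y))
    (hA : ∀ y ∈ U, ∀ X, fderiv ℝ ξ y X = -(α • fderiv ℝ f y X + β • fderiv ℝ f y (J y X)))
    {y : E} (hy : y ∈ U) (Z X : E) :
    pseudoInner m s (fderiv ℝ ξ y Z) (fderiv ℝ f y X) = 0 := by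
  -- The second component is a primitive of `df ∘ J`, obtained by solving the Weingarten formula for
  -- `df (J X)`.
  set G : E → (Fin m → ℝ) × (Fin m → ℝ) := fun z => (f z, -β⁻¹ • (ξ z + α • f z)) with hGdef
  have hG : ∀ z ∈ U, ContDiffAt ℝ ∞ G z := fun z hz =>
    (hf z hz).prodMk (((hξ z hz).add ((hf z hz).const_smul α)).const_smul (-β⁻¹))
  have hdG : ∀ z ∈ U, ∀ X, fderiv ℝ G z X = (fderiv ℝ f z X, fderiv ℝ f z (J z X)) := by
    intro z hz X
    have df := ((hf z hz).differentiableAt (by simp)).hasFDerivAt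
    have dξ := ((hξ z hz).differentiableAt (by simp)).hasFDerivAt
    have h : HasFDerivAt G _ z := df.prodMk ((dξ.add (df.const_smul α)).const_smul (-β⁻¹))
    rw [h.fderiv]
    refine Prod.ext rfl ?_
    change -β⁻¹ • (fderiv ℝ ξ z X + α • fderiv ℝ f z X) = fderiv ℝ f z (J z X)
    rw [hA z hz, add_comm (α • _), neg_add, neg_add_cancel_right, neg_smul, smul_neg, neg_neg,
      inv_smul_smul₀ hβ]
  have hiso : ∀ z ∈ U, ∀ X Y, doubledInner m s (fderiv ℝ G z X) (fderiv ℝ G z Y) = 0 := by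
    intro z hz X Y
    rw [hdG z hz, hdG z hz, doubledInner_apply]
    simp only [hJ z hz, add_neg_cancel]
  let I : (Fin m → ℝ) × (Fin m → ℝ) →L[ℝ] (Fin m → ℝ) × (Fin m → ℝ) :=
    (ContinuousLinearMap.snd ℝ _ _).prod (-ContinuousLinearMap.fst ℝ _ _)
  have hI : ∀ u v, doubledInner m s (I u) v = -doubledInner m s u (I v) := by
    intro u v
    change pseudoInner m s u.2 v.1 + pseudoInner m s (-u.1) v.2 =
      -(pseudoInner m s u.1 v.2 + pseudoInner m s u.2 (-v.1))
    simp only [map_neg, LinearMap.neg_apply]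
    ring
  have hJI : ∀ z ∈ U, ∀ X, fderiv ℝ G z (J z X) = I (fderiv ℝ G z X) := by
    intro z hz X
    rw [hdG z hz, hdG z hz, hJJ z hz, map_neg]
    rfl
  have hJs : ∀ z ∈ U, Function.Surjective (J z) := fun z hz X =>
    ⟨J z (-X), by rw [hJJ z hz, neg_neg]⟩
  have hDinj : Function.Injective (fderiv ℝ G y) := fun X Y h => by
    rw [hdG y hy, hdG y hy] at h
    exact hinj y hy (congrArg Prod.fst h)
  obtain ⟨W, hW⟩ := mem_range_of_isotropic hm hE (fderiv ℝ G y).toLinearMap hDinj (hiso y hy)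
    (secondDeriv_orthogonal hU hG _ (doubledInner_comm m s) hiso hy Z X)
    (secondDeriv_isotropic hU hG _ (doubledInner_comm m s) hiso I hI J hJI hJs hy Z X Z X)
  have dξ := ((hξ y hy).differentiableAt (by simp)).hasFDerivAt
  -- Pairing with `(ξ, 0)` sees only the `f` component. The term with the second derivative drops
  -- out, since that vector is `dG W` and `ξ` is normal to `df W`.
  have ha : HasFDerivAt (fun z => (ξ z, (0 : Fin m → ℝ))) _ y :=
    dξ.prodMk (hasFDerivAt_const _ y)
  have h := bilin_fderiv_add_eq_zero (doubledInner m s) ha.differentiableAt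
    ((hG y hy).differentiableAt_fderiv_apply X)
    (Filter.eventually_of_mem (hU.mem_nhds hy) fun z hz => by
      rw [hdG z hz, doubledInner_apply]
      simp [hn z hz X]) Z
  rw [(hG y hy).fderiv_fderiv_apply, ← hW, ha.fderiv] at h
  change doubledInner m s (fderiv ℝ ξ y Z, 0) (fderiv ℝ G y X) +
    doubledInner m s (ξ y, 0) (fderiv ℝ G y W) = 0 at h
  rw [hdG y hy, hdG y hy, doubledInner_apply, doubledInner_apply] at h
  simpa [hn y hy W] using h

end ComplexShape

/-! ### Linear algebra of the normal form. -/

theorem Matrix.det_fin_four_blockDiagonal {R : Type*} [CommRing R] (a b c d a' b' c' d' : R) :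
    Matrix.det !![a, b, 0, 0; c, d, 0, 0; 0, 0, a', b'; 0, 0, c', d'] =
      (a * d - b * c) * (a' * d' - b' * c') := by
  rw [Matrix.det_succ_row_zero]
  simp [Fin.sum_univ_four, Matrix.det_fin_three, Fin.succAbove]
  ring

namespace HasPetrovFormII

variable {V : Type*} [AddCommGroup V] [Module ℝ V] {A : Module.End ℝ V}
  {g : LinearMap.BilinForm ℝ V}

theorem roots_charpoly [Module.Finite ℝ V] {α₁ β₁ α₂ β₂ : ℝ}
    (h : HasPetrovFormII A g α₁ β₁ α₂ β₂) :
    (A.charpoly.map (algebraMap ℝ ℂ)).roots =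
      {⟨α₁, β₁⟩, ⟨α₁, -β₁⟩, ⟨α₂, β₂⟩, ⟨α₂, -β₂⟩} := by
  obtain ⟨e, hA, -⟩ := h
  have hc : A.charpoly.map (algebraMap ℝ ℂ) = (({⟨α₁, β₁⟩, ⟨α₁, -β₁⟩, ⟨α₂, β₂⟩, ⟨α₂, -β₂⟩} :
      Multiset ℂ).map fun a => Polynomial.X - Polynomial.C a).prod := by
    have hC : ∀ a b : ℝ, (Polynomial.C (⟨a, b⟩ : ℂ)) =
        Polynomial.C (a : ℂ) + Polynomial.C (b : ℂ) * Polynomial.C Complex.I := fun a b => by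
      rw [← Polynomial.C_mul, ← Polynomial.C_add, Complex.mk_eq_add_mul_I]
    have hI : (Polynomial.C Complex.I) ^ 2 = -1 := by
      rw [← Polynomial.C_pow, Complex.I_sq, Polynomial.C_neg, Polynomial.C_1]
    rw [← LinearMap.charpoly_toMatrix A e, hA]
    have hM : Matrix.charmatrix !![α₁, -β₁, 0, 0; β₁, α₁, 0, 0; 0, 0, α₂, -β₂; 0, 0, β₂, α₂] =
        !![Polynomial.X - Polynomial.C α₁, Polynomial.C β₁, 0, 0;
          -Polynomial.C β₁, Polynomial.X - Polynomial.C α₁, 0, 0;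
          0, 0, Polynomial.X - Polynomial.C α₂, Polynomial.C β₂;
          0, 0, -Polynomial.C β₂, Polynomial.X - Polynomial.C α₂] := by
      ext i j : 1
      fin_cases i <;> fin_cases j <;> simp
    rw [Matrix.charpoly, hM, Matrix.det_fin_four_blockDiagonal]
    have h₁ := hC α₁ β₁
    have h₁' := hC α₁ (-β₁)
    have h₂ := hC α₂ β₂
    have h₂' := hC α₂ (-β₂)
    simp only [Multiset.insert_eq_cons, Multiset.map_cons, Multiset.prod_cons,
      Multiset.map_singleton, Multiset.prod_singleton, Polynomial.map_mul, Polynomial.map_sub,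
      Polynomial.map_neg, Polynomial.map_X, Polynomial.map_C, Complex.coe_algebraMap,
      h₁, h₁', h₂, h₂', Complex.ofReal_neg, Polynomial.C_neg]
    -- With the constants turned into variables, only `I² = -1` is needed to split each quadratic
    -- factor.
    generalize (Polynomial.C Complex.I) = I at hI
    generalize (Polynomial.C (α₁ : ℂ)) = a₁
    generalize (Polynomial.C (α₂ : ℂ)) = a₂
    generalize (Polynomial.C (β₁ : ℂ)) = b₁
    generalize (Polynomial.C (β₂ : ℂ)) = b₂
    have factor : ∀ a b : Polynomial ℂ, (Polynomial.X - (a + b * I)) * (Polynomial.X - (a + -b * I)) =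
        (Polynomial.X - a) * (Polynomial.X - a) - b * -b := fun a b => by
      linear_combination (-b ^ 2) * hI
    rw [← mul_assoc, factor, factor]
  rw [hc, Polynomial.roots_multiset_prod_X_sub_C]

/-- Since both `β`s are positive, `α₁ + iβ₁` differs from the two roots in the lower half plane, so
its second occurrence can only be `α₂ + iβ₂`. -/
theorem eq_of_count_eq_two [Module.Finite ℝ V] {α₁ β₁ α₂ β₂ : ℝ}
    (h : HasPetrovFormII A g α₁ β₁ α₂ β₂) (hβ₁ : 0 < β₁) (hβ₂ : 0 < β₂)
    (h2 : ∀ z ∈ (A.charpoly.map (algebraMap ℝ ℂ)).roots, z.im ≠ 0 →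
      (A.charpoly.map (algebraMap ℝ ℂ)).roots.count z = 2) : α₁ = α₂ ∧ β₁ = β₂ := by
  rw [h.roots_charpoly] at h2
  have h3 := h2 ⟨α₁, β₁⟩ (by simp) hβ₁.ne'
  have n1 : β₁ ≠ -β₁ := by linarith
  have n2 : β₁ ≠ -β₂ := by linarith
  by_contra hne
  have n3 : ¬ (⟨α₁, β₁⟩ : ℂ) = ⟨α₂, β₂⟩ := by simpa [Complex.ext_iff] using hne
  simp [n3, n1, n2] at h3

/-- `J` rotates each of the two blocks, exchanging a timelike and a spacelike unit vector up to
sign; hence it is an anti-isometry. The last clause is what the final contradiction refutes; it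
holds because `g (A e₀) e₁ = β`. -/
theorem exists_complexStructure {α β : ℝ} (hβ : β ≠ 0) (h : HasPetrovFormII A g α β α β) :
    ∃ J : Module.End ℝ V, (∀ X, J (J X) = -X) ∧ (∀ X Y, g (J X) (J Y) = -g X Y) ∧
      (∀ X, A X = α • X + β • J X) ∧ ∃ X Y, g (A X) Y ≠ 0 := by
  obtain ⟨e, hA, hg⟩ := h
  have hg' : ∀ i j, g (e i) (e j) = _ := fun i j => congrFun (congrFun hg i) j
  have hAe : ∀ j, A (e j) = ∑ i, (LinearMap.toMatrix e e A) i j • e i := fun j => by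
    rw [← Matrix.toLin_self e e, Matrix.toLin_toMatrix]
  rw [hA] at hAe
  let J : Module.End ℝ V := e.constr ℝ ![e 1, -e 0, e 3, -e 2]
  have hJ : ∀ i, J (e i) = ![e 1, -e 0, e 3, -e 2] i := fun i => e.constr_basis ℝ _ i
  have hAJ : ∀ X, A X = α • X + β • J X := by
    intro X
    refine LinearMap.congr_fun (f := A) (g := α • LinearMap.id + β • J) (e.ext fun i => ?_) X
    fin_cases i <;> simp [hAe, hJ, Fin.sum_univ_four, add_comm]
  refine ⟨J, fun X => ?_, fun X Y => ?_, hAJ, e 0, e 1, ?_⟩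
  · refine LinearMap.congr_fun (f := J ∘ₗ J) (g := -LinearMap.id) (e.ext fun i => ?_) X
    fin_cases i <;> simp [hJ]
  · refine LinearMap.congr_fun₂ (f := g.compl₁₂ J J) (g := -g)
      (LinearMap.ext_basis e e fun i j => ?_) X Y
    fin_cases i <;> fin_cases j <;> simp [hJ, hg']
  · rw [hAJ]
    simpa [hJ, hg'] using hβ

end HasPetrovFormII

/-! ### The Weingarten formula and passage to a chart. -/

namespace Hypersurface

variable {N : SpaceForm} {n s : ℕ} {M : Type*} [TopologicalSpace M]
  [ChartedSpace (EuclideanSpace ℝ (Fin n)) M]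

/-- The Weingarten formula in the surrounding pseudo-Euclidean space. -/
theorem differential_normal (H : Hypersurface N n s M) (x : M) (X : TangentSpace (𝓡 n) x) :
    differential H.ξ x X = -differential H.ι x (H.shapeOperator x X) := by
  rw [H.differential_shapeOperator, neg_neg]
  cases N with
  | euclidean => simp [covDerivNormal, SpaceForm.tangentProj, SpaceForm.curvature]
  | sphere =>
    -- Differentiating `⟨ι, ξ⟩ = 0` and using `⟨dι X, ξ⟩ = 0` gives `⟨ι, dξ X⟩ = 0`, so `dξ X` is
    -- already tangent to the sphere.
    have h := pseudoInner_differential_add (H.smooth_ι.mdifferentiableAt (x := x) (by simp))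
      (H.smooth_ξ.mdifferentiableAt (x := x) (by simp)) (fun y => H.ξ_tangent y) X
    rw [pseudoInner_comm, H.ξ_normal, zero_add] at h
    change _ = differential H.ξ x X -
      (1 : ℝ) • pseudoInner _ s (H.ι x) (differential H.ξ x X) • H.ι x
    rw [h, zero_smul, smul_zero, sub_zero]

end Hypersurface

section Charts

variable {n m : ℕ} {M : Type*} [TopologicalSpace M] [ChartedSpace (EuclideanSpace ℝ (Fin n)) M]
  [IsManifold (𝓡 n) ∞ M]

theorem contDiffAt_comp_chartAt_symm {f : M → Fin m → ℝ}
    (hf : ContMDiff (𝓡 n) 𝓘(ℝ, Fin m → ℝ) ∞ f) (x : M) {y : EuclideanSpace ℝ (Fin n)}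
    (hy : y ∈ (chartAt (EuclideanSpace ℝ (Fin n)) x).target) :
    ContDiffAt ℝ ∞ (f ∘ (chartAt (EuclideanSpace ℝ (Fin n)) x).symm) y := by
  rw [← contMDiffAt_iff_contDiffAt]
  exact hf.contMDiffAt.comp y (contMDiffOn_chart_symm.contMDiffAt
    ((chartAt (EuclideanSpace ℝ (Fin n)) x).open_target.mem_nhds hy))

theorem mdifferentiable_chartAt (x : M) :
    (chartAt (EuclideanSpace ℝ (Fin n)) x).MDifferentiable (𝓡 n) (𝓡 n) :=
  haveI : IsManifold (𝓡 n) 1 M := IsManifold.of_le (n := ∞) (by simp)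
  mdifferentiable_chart x

/-- The derivative of the inverse of a chart, as an isomorphism onto the tangent space. -/
noncomputable def chartAtSymmDeriv (x : M) {y : EuclideanSpace ℝ (Fin n)}
    (hy : y ∈ (chartAt (EuclideanSpace ℝ (Fin n)) x).target) :
    EuclideanSpace ℝ (Fin n) ≃L[ℝ]
      TangentSpace (𝓡 n) ((chartAt (EuclideanSpace ℝ (Fin n)) x).symm y) :=
  (mdifferentiable_chartAt x).symm.mfderiv hy

theorem fderiv_comp_chartAt_symm {f : M → Fin m → ℝ}
    (hf : ContMDiff (𝓡 n) 𝓘(ℝ, Fin m → ℝ) ∞ f) (x : M) {y : EuclideanSpace ℝ (Fin n)}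
    (hy : y ∈ (chartAt (EuclideanSpace ℝ (Fin n)) x).target) (X : EuclideanSpace ℝ (Fin n)) :
    fderiv ℝ (f ∘ (chartAt (EuclideanSpace ℝ (Fin n)) x).symm) y X =
      differential f ((chartAt (EuclideanSpace ℝ (Fin n)) x).symm y) (chartAtSymmDeriv x hy X) := by
  rw [← mfderiv_eq_fderiv, mfderiv_comp y (hf.mdifferentiableAt (by simp))
    ((mdifferentiable_chartAt x).mdifferentiableAt_symm hy)]
  rfl

end Charts

/-! ### The nonexistence theorem. -/

theorem SpaceForm.le_coordDim (N : SpaceForm) (n : ℕ) : n ≤ N.coordDim n := by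
  cases N
  · exact le_rfl
  · exact Nat.le_succ n

theorem theorem4p5 {M : Type*} [TopologicalSpace M] [ChartedSpace (EuclideanSpace ℝ (Fin 4)) M]
    [IsManifold (𝓡 4) ∞ M] [ConnectedSpace M] (N : SpaceForm) :
    ¬ ∃ H : Hypersurface N 4 2 M,
      H.IsIsoparametric ∧ H.IsPetrovTypeII ∧ H.ComplexMultiplicitiesEqTwo := by
  rintro ⟨H, -, ⟨α₁, β₁, α₂, β₂, hβ₁, hβ₂, hP⟩, hmul⟩
  obtain ⟨x₀⟩ := (inferInstance : Nonempty M)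
  obtain ⟨rfl, rfl⟩ := (hP x₀).eq_of_count_eq_two hβ₁ hβ₂ (hmul x₀)
  -- `J` is chosen pointwise, with no continuity; none is required below.
  choose J hJJ hJg hAJ X Y hXY using fun x => (hP x).exists_complexStructure hβ₁.ne'
  have hx₀ := mem_chart_target (EuclideanSpace ℝ (Fin 4)) x₀
  let φ := chartAt (EuclideanSpace ℝ (Fin 4)) x₀
  classical
  -- `J` read in the chart around `x₀`; the value `0` off the chart target is never used.
  let J' : EuclideanSpace ℝ (Fin 4) → EuclideanSpace ℝ (Fin 4) → EuclideanSpace ℝ (Fin 4) :=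
    fun y v => if hy : y ∈ φ.target then
      (chartAtSymmDeriv x₀ hy).symm (J (φ.symm y) (chartAtSymmDeriv x₀ hy v)) else 0
  have hJ' : ∀ y (hy : y ∈ φ.target) v,
      chartAtSymmDeriv x₀ hy (J' y v) = J (φ.symm y) (chartAtSymmDeriv x₀ hy v) := by
    intro y hy v
    simp only [J', dif_pos hy, ContinuousLinearEquiv.apply_symm_apply]
  have key := pseudoInner_fderiv_normal_eq_zero (s := 2) (α := α₁) (β := β₁)
    ((by norm_num : 2 ≤ 4 + 1).trans (N.le_coordDim (4 + 1))) (by simp) φ.open_target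
    (fun y hy => contDiffAt_comp_chartAt_symm H.smooth_ι x₀ hy)
    (fun y hy => contDiffAt_comp_chartAt_symm H.smooth_ξ x₀ hy)
    (fun y hy v w h => by
      rw [fderiv_comp_chartAt_symm H.smooth_ι x₀ hy,
        fderiv_comp_chartAt_symm H.smooth_ι x₀ hy] at h
      exact (chartAtSymmDeriv x₀ hy).injective (H.immersion _ h))
    (fun y hy v => by
      rw [fderiv_comp_chartAt_symm H.smooth_ι x₀ hy]
      exact H.ξ_normal _ _)
    hβ₁.ne' J'
    (fun y hy v => (chartAtSymmDeriv x₀ hy).injective (by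
      rw [hJ' y hy, hJ' y hy, hJJ, map_neg]))
    (fun y hy v w => by
      simp only [fderiv_comp_chartAt_symm H.smooth_ι x₀ hy, hJ' y hy]
      exact hJg _ _ _)
    (fun y hy v => by
      rw [fderiv_comp_chartAt_symm H.smooth_ι x₀ hy, fderiv_comp_chartAt_symm H.smooth_ι x₀ hy,
        fderiv_comp_chartAt_symm H.smooth_ξ x₀ hy, H.differential_normal, hAJ, map_add, map_smul,
        map_smul, hJ' y hy])
    hx₀ ((chartAtSymmDeriv x₀ hx₀).symm (X _)) ((chartAtSymmDeriv x₀ hx₀).symm (Y _))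
  rw [fderiv_comp_chartAt_symm H.smooth_ι x₀ hx₀, fderiv_comp_chartAt_symm H.smooth_ξ x₀ hx₀,
    ContinuousLinearEquiv.apply_symm_apply, ContinuousLinearEquiv.apply_symm_apply,
    H.differential_normal, map_neg, LinearMap.neg_apply, neg_eq_zero] at key
  exact hXY _ key
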